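/- Let $K$ be a finite simplicial complex of dimension $n$ (so $K$ is nonempty), let $\mathbb F$ be a finite field, and let $f\colon K\to\mathbb R$ be an excellent discrete Morse function. That is: for every simplex $\sigma\in K$ of dimension $p$ there is at most one $(p+1)$-dimensional coface $\tau\succ\sigma$ with $f(\tau)\le f(\sigma)$ and at most one $(p-1)$-dimensional face $\upsilon\prec\sigma$ with $f(\sigma)\le f(\upsilon)$; the simplex $\sigma$ is called critical if there is no such $\tau$ and no such $\upsilon$; and distinct critical simplices have distinct values. Let $C_q$ be the number of critical simplices of dimension $q$ and let $\beta_q=\dim_{\mathbb F}H_q(K;\mathbb F)$ be the $q$-th Betti number. For $c\in\mathbb R$ let $K(c)$ be the subcomplex of all simplices $\sigma$ with $f(\sigma)\le c$ together with all their faces, and let $K(c^-)$ be the subcomplex of all simplices $\sigma$ with $f(\sigma)<c$ together with all their faces. A pair $(\sigma,\tau)$ of critical simplices with $f(\sigma)<f(\tau)$ is called a (finite) persistence pair if for some $p$ there is a homology class $x\in H_p(K(f(\sigma));\mathbb F)$ such that * $x$ is born at $\sigma$: $x$ is not in the image of $H_p(K(f(\sigma)^-);\mathbb F)$; and * $x$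 dies at $\tau$, according to the elder rule: the image of $x$ in $H_p(K(f(\tau));\mathbb F)$ is zero, while the image of $x$ in $H_p(K(f(\tau)^-);\mathbb F)$ is not in the image of $H_p(K(f(\sigma)^-);\mathbb F)$ (all maps being induced by inclusions). Let $\hat P_q$ be the set of such pairs $(\sigma,\tau)$ with $\dim\sigma=q$. Then $$C_n-C_{n-1}+\cdots\pm C_0=\beta_n-\beta_{n-1}+\cdots\pm\beta_0,$$ and, for every $i=0,1,\dots,n$, $$C_i-C_{i-1}+\cdots\pm C_0=\beta_i-\beta_{i-1}+\cdots\pm\beta_0+\#\hat P_i .$$ -/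

import Mathlib

namespace DiscreteMorse

section Subquotient

variable {F E : Type*} [Field F] [AddCommGroup E] [Module F E]

/-- The quotient `Z / B` (that is, `Z / (Z ∩ B)`; it is used with `B ≤ Z`). -/
def Subquotient (Z B : Submodule F E) : Type _ := Z ⧸ B.submoduleOf Z

instance (Z B : Submodule F E) : AddCommGroup (Subquotient Z B) :=
  inferInstanceAs (AddCommGroup (Z ⧸ B.submoduleOf Z))

instance (Z B : Submodule F E) : Module F (Subquotient Z B) :=
  inferInstanceAs (Module F (Z ⧸ B.submoduleOf Z))

/-- The map `Z / B → Z' / B'` induced by the inclusions `Z ≤ Z'` and `B ≤ B'`. -/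
def Subquotient.map {Z B Z' B' : Submodule F E} (hZ : Z ≤ Z') (hB : B ≤ B') :
    Subquotient Z B →ₗ[F] Subquotient Z' B' :=
  Submodule.mapQ (B.submoduleOf Z) (B'.submoduleOf Z') (Submodule.inclusion hZ)
    (fun _ hz => hB hz)

end Subquotient

section Homology

variable {ι : Type*} (F : Type*) [Field F]

/-- `C_q(K; F)`: formal combinations of the simplices of `K` of dimension `q`
(those with `q + 1` vertices). -/
noncomputable def chains (K : PreAbstractSimplicialComplex ι) (q : ℕ) :
    Submodule F (Finset ι →₀ F) :=
  Finsupp.supported F F {σ | σ ∈ K ∧ σ.card = q + 1}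

theorem chains_mono {L M : PreAbstractSimplicialComplex ι} (h : L ≤ M) (q : ℕ) :
    chains F L q ≤ chains F M q :=
  Finsupp.supported_mono fun _ hσ => ⟨h hσ.1, hσ.2⟩

variable [LinearOrder ι]

/-- The boundary of the simplex `σ = {v₀ < ⋯ < v_q}`, namely `∑ᵢ (-1)ⁱ (σ \ {vᵢ})`.
The boundary of a vertex is zero (the chain complex is not augmented). -/
noncomputable def simplexBoundary (σ : Finset ι) : Finset ι →₀ F :=
  if σ.card ≤ 1 then 0
  else ∑ v ∈ σ, Finsupp.single (σ.erase v) ((-1 : F) ^ (σ.filter (fun w => w < v)).card)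

/-- The linear extension of `simplexBoundary` to all finite formal combinations of simplices on
the vertex type `ι`; the boundary operator of every complex on `ι` is a restriction of it. -/
noncomputable def boundary : (Finset ι →₀ F) →ₗ[F] (Finset ι →₀ F) :=
  Finsupp.linearCombination F (simplexBoundary F)

/-- `Z_q(K; F)`: the `q`-cycles. -/
noncomputable def cycles (K : PreAbstractSimplicialComplex ι) (q : ℕ) : Submodule F (Finset ι →₀ F) :=
  chains F K q ⊓ LinearMap.ker (boundary F)

/-- `B_q(K; F)`: the `q`-boundaries. -/
noncomputable def boundaries (K : PreAbstractSimplicialComplex ι) (q : ℕ) : Submodule F (Finset ι →₀ F) :=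
  (chains F K (q + 1)).map (boundary F)

/-- `H_q(K; F) = Z_q(K; F) / B_q(K; F)`. -/
abbrev Homology (K : PreAbstractSimplicialComplex ι) (q : ℕ) : Type _ :=
  Subquotient (cycles F K q) (boundaries F K q)

/-- The `q`-th Betti number over `F`. -/
noncomputable def betti (K : PreAbstractSimplicialComplex ι) (q : ℕ) : ℕ :=
  Module.finrank F (Homology F K q)

theorem cycles_mono {L M : PreAbstractSimplicialComplex ι} (h : L ≤ M) (q : ℕ) :
    cycles F L q ≤ cycles F M q :=
  inf_le_inf_right _ (chains_mono F h q)

theorem boundaries_mono {L M : PreAbstractSimplicialComplex ι} (h : L ≤ M) (q : ℕ) :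
    boundaries F L q ≤ boundaries F M q :=
  Submodule.map_mono (chains_mono F h (q + 1))

/-- The map `H_q(L; F) → H_q(M; F)` induced by the inclusion of a subcomplex `L` of `M`. -/
noncomputable def homologyMap {L M : PreAbstractSimplicialComplex ι} (h : L ≤ M) (q : ℕ) :
    Homology F L q →ₗ[F] Homology F M q :=
  Subquotient.map (cycles_mono F h q) (boundaries_mono F h q)

end Homology

section Morse

variable {ι : Type*} {K : PreAbstractSimplicialComplex ι}

/-- The dimension of `K`, the maximum of the dimensions of its simplices, is `n`. -/
def HasDimension (K : PreAbstractSimplicialComplex ι) (n : ℕ) : Prop :=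
  IsGreatest {d : ℕ | ∃ σ ∈ K, σ.card = d + 1} n

/-- The cofaces `τ` of `σ` of one dimension more with `f τ ≤ f σ`. -/
def exceptionalCofaces (f : K → ℝ) (σ : K) : Set K :=
  {τ | σ.1 ⊂ τ.1 ∧ τ.1.card = σ.1.card + 1 ∧ f τ ≤ f σ}

/-- The faces `υ` of `σ` of one dimension less with `f σ ≤ f υ`. -/
def exceptionalFaces (f : K → ℝ) (σ : K) : Set K :=
  {υ | υ.1 ⊂ σ.1 ∧ υ.1.card + 1 = σ.1.card ∧ f σ ≤ f υ}

/-- `f` is a discrete Morse function on `K`. -/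
def IsDiscreteMorse (f : K → ℝ) : Prop :=
  ∀ σ : K, (exceptionalCofaces f σ).encard ≤ 1 ∧ (exceptionalFaces f σ).encard ≤ 1

/-- `σ` is a critical simplex of `f`. -/
def IsCritical (f : K → ℝ) (σ : K) : Prop :=
  (exceptionalCofaces f σ).encard = 0 ∧ (exceptionalFaces f σ).encard = 0

/-- `f` is excellent: distinct critical simplices have distinct critical values. -/
def IsExcellent (f : K → ℝ) : Prop :=
  Set.InjOn f {σ | IsCritical f σ}

/-- `C_q`: the number of critical simplices of dimension `q`. -/
noncomputable def critCount (f : K → ℝ) (q : ℕ) : ℕ :=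
  {σ : K | IsCritical f σ ∧ σ.1.card = q + 1}.ncard

/-- The sublevel complex `K(c)`: all simplices `σ` with `f σ ≤ c` and all their faces. -/
def sublevel (f : K → ℝ) (c : ℝ) : PreAbstractSimplicialComplex ι where
  faces := {τ | τ.Nonempty ∧ ∃ σ : K, f σ ≤ c ∧ τ ⊆ σ.1}
  isRelLowerSet_faces := fun _ hτ =>
    ⟨hτ.1, fun _ hρ hne => ⟨hne, hτ.2.imp fun _ h => ⟨h.1, hρ.trans h.2⟩⟩⟩

/-- The simplices `σ` with `f σ < c` and all their faces. If `c = c_j` is one of the finitely many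
values `c_1 < ⋯ < c_m` of `f`, this is the complex `K(c_{j-1})` preceding `K(c_j)` in the
filtration (the empty complex if `j = 1`). -/
def strictSublevel (f : K → ℝ) (c : ℝ) : PreAbstractSimplicialComplex ι where
  faces := {τ | τ.Nonempty ∧ ∃ σ : K, f σ < c ∧ τ ⊆ σ.1}
  isRelLowerSet_faces := fun _ hτ =>
    ⟨hτ.1, fun _ hρ hne => ⟨hne, hτ.2.imp fun _ h => ⟨h.1, hρ.trans h.2⟩⟩⟩

theorem strictSublevel_le_sublevel (f : K → ℝ) {a b : ℝ} (h : a ≤ b) :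
    strictSublevel f a ≤ sublevel f b :=
  fun _ hτ => ⟨hτ.1, hτ.2.imp fun _ hσ => ⟨hσ.1.le.trans h, hσ.2⟩⟩

theorem sublevel_le_strictSublevel (f : K → ℝ) {a b : ℝ} (h : a < b) :
    sublevel f a ≤ strictSublevel f b :=
  fun _ hτ => ⟨hτ.1, hτ.2.imp fun _ hσ => ⟨hσ.1.trans_lt h, hσ.2⟩⟩

theorem sublevel_mono (f : K → ℝ) {a b : ℝ} (h : a ≤ b) : sublevel f a ≤ sublevel f b :=
  fun _ hτ => ⟨hτ.1, hτ.2.imp fun _ hσ => ⟨hσ.1.trans h, hσ.2⟩⟩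

theorem strictSublevel_mono (f : K → ℝ) {a b : ℝ} (h : a ≤ b) :
    strictSublevel f a ≤ strictSublevel f b :=
  fun _ hτ => ⟨hτ.1, hτ.2.imp fun _ hσ => ⟨hσ.1.trans_le h, hσ.2⟩⟩

variable [LinearOrder ι] (F : Type*) [Field F]

/-- A class `x ∈ H_p(K(c); F)` is born at `c`: it does not come from the preceding complex. -/
def BornAt (f : K → ℝ) (c : ℝ) (p : ℕ) (x : Homology F (sublevel f c) p) : Prop :=
  x ∉ LinearMap.range (homologyMap F (strictSublevel_le_sublevel f (le_refl c)) p)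

/-- A class `x ∈ H_p(K(c); F)` (thought of as born at `c`) dies at `d > c`: its image in
`H_p(K(d); F)` is zero, while just before `d` it is still a class that is younger than every class
born before `c` (elder rule: the class that dies at `d` must not be identified, just before `d`,
with one that was already present before `c`; in particular it is nonzero just before `d`). -/
def DiesAt (f : K → ℝ) (c : ℝ) (p : ℕ) (x : Homology F (sublevel f c) p) (d : ℝ) : Prop :=
  ∃ h : c < d,
    homologyMap F (sublevel_le_strictSublevel f h) p x ∉
      LinearMap.range (homologyMap F (strictSublevel_mono f h.le) p) ∧
    homologyMap F (sublevel_mono f h.le) p x = 0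

/-- `(σ, τ)` is a persistence pair (with finite death simplex): `σ` and `τ` are critical simplices
and some homology class, of some degree `p`, is born at `σ` and dies at `τ`.
Only critical simplices are eligible, since a non-critical simplex may share its value with a
critical one, whereas the critical simplex with a given critical value is unique. No relation
between `p`, `dim σ` and `dim τ` is imposed. -/
def IsPersistencePair (f : K → ℝ) (σ τ : K) : Prop :=
  IsCritical f σ ∧ IsCritical f τ ∧
    ∃ (p : ℕ) (x : Homology F (sublevel f (f σ)) p),
      BornAt F f (f σ) p x ∧ DiesAt F f (f σ) p x (f τ)

/-- `P̂_q`: the persistence pairs whose birth simplex has dimension `q` and whose death simplex is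
not infinity. -/
def finitePairs (f : K → ℝ) (q : ℕ) : Set (K × K) :=
  {s | IsPersistencePair F f s.1 s.2 ∧ s.1.1.card = q + 1}

end Morse

end DiscreteMorse

namespace DiscreteMorse

/-! ### Simplices that enter the filtration at level `c` -/

section Levels

variable {ι : Type*} {K : PreAbstractSimplicialComplex ι} {f : K → ℝ} {c : ℝ}

/-! Pass from K(c⁻) to K(c) one value at a time. The simplices that enter are matched in exceptional
face-coface pairs, except for at most one critical simplex (`level_cases`). Eliminating the pairs,
every chain of K(c) whose boundary lies in K(c⁻) becomes, up to a boundary, an old chain plus a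
multiple of the critical simplex s (`exists_sub_boundary`, `exists_decomposition`).

So only s can change homology. If ∂s already bounds an old chain, s is a creator: it adds one class
in its own dimension. Otherwise it is a destroyer: it kills the class of ∂s one dimension lower
(`betti_sublevel`). Summing over the values gives β_q + #destroyers(q+1) = #creators(q), while C_q =
#creators(q) + #destroyers(q). In the alternating sum everything telescopes except #destroyers(i+1).

Finally (σ, τ) ↦ τ is a bijection from the finite pairs with dim σ = q onto the destroyers of
dimension q+1 (`ncard_finitePairs`): σ is the critical simplex at the first level where the class of
∂τ in K(f(τ)⁻) has a representative. In dimension n+1 there are no destroyers, which gives the first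
identity. -/

theorem nonempty_of_mem {s : Finset ι} (hs : s ∈ K) : s.Nonempty :=
  (K.isRelLowerSet_faces hs).1

theorem mem_of_subset {s t : Finset ι} (ht : t ∈ K) (hst : s ⊆ t) (hs : s.Nonempty) : s ∈ K :=
  (K.isRelLowerSet_faces ht).2 hst hs

theorem sublevel_le (f : K → ℝ) (c : ℝ) : sublevel f c ≤ K :=
  fun _ hs => mem_of_subset hs.2.choose.2 hs.2.choose_spec.2 hs.1

theorem mem_strictSublevel_of_lt {s : K} (h : f s < c) : s.1 ∈ strictSublevel f c :=
  ⟨nonempty_of_mem s.2, s, h, Finset.Subset.refl _⟩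

theorem mem_sublevel_of_le {s : K} (h : f s ≤ c) : s.1 ∈ sublevel f c :=
  ⟨nonempty_of_mem s.2, s, h, Finset.Subset.refl _⟩

theorem IsDiscreteMorse.coface_unique (hf : IsDiscreteMorse f) {s t t' : K}
    (ht : t ∈ exceptionalCofaces f s) (ht' : t' ∈ exceptionalCofaces f s) : t = t' :=
  Set.encard_le_one_iff.1 (hf s).1 _ _ ht ht'

theorem IsDiscreteMorse.face_unique (hf : IsDiscreteMorse f) {s t t' : K}
    (ht : t ∈ exceptionalFaces f s) (ht' : t' ∈ exceptionalFaces f s) : t = t' :=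
  Set.encard_le_one_iff.1 (hf s).2 _ _ ht ht'

theorem IsCritical.notMem_coface {s : K} (h : IsCritical f s) (t : K) :
    t ∉ exceptionalCofaces f s := by
  rw [Set.encard_eq_zero.1 h.1]; exact Set.notMem_empty _

theorem IsCritical.notMem_face {s : K} (h : IsCritical f s) (t : K) :
    t ∉ exceptionalFaces f s := by
  rw [Set.encard_eq_zero.1 h.2]; exact Set.notMem_empty _

/-- Among the facets of `r` containing a face `s` of codimension at least two and different from
a given `t`, one has a smaller value than `r`. -/
theorem IsDiscreteMorse.exists_facet (hf : IsDiscreteMorse f) {s r : K}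
    (hsr : s.1 ⊂ r.1) (hcard : s.1.card + 1 < r.1.card) :
    ∃ t : K, s.1 ⊂ t.1 ∧ t.1 ⊂ r.1 ∧ t.1.card + 1 = r.1.card ∧ f t < f r := by
  classical
  have h2 : 1 < (r.1 \ s.1).card := by
    rw [Finset.card_sdiff_of_subset hsr.1]; omega
  obtain ⟨a, ha, b, hb, hab⟩ := Finset.one_lt_card.1 h2
  rw [Finset.mem_sdiff] at ha hb
  have key : ∀ v, v ∈ r.1 ∧ v ∉ s.1 → s.1 ⊂ r.1.erase v ∧ r.1.erase v ∈ K ∧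
      r.1.erase v ⊂ r.1 ∧ (r.1.erase v).card + 1 = r.1.card := by
    intro v hv
    have hc := Finset.card_erase_add_one hv.1
    have hsub : s.1 ⊆ r.1.erase v := Finset.subset_erase.2 ⟨hsr.1, hv.2⟩
    refine ⟨(Finset.ssubset_iff_subset_ne.2 ⟨hsub, fun h => ?_⟩), ?_,
      Finset.erase_ssubset hv.1, hc⟩
    · rw [h] at hcard; omega
    · exact mem_of_subset r.2 (Finset.erase_subset _ _) ((nonempty_of_mem s.2).mono hsub)
  obtain ⟨a1, a2, a3, a4⟩ := key a ha
  obtain ⟨b1, b2, b3, b4⟩ := key b hb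
  by_contra! hcon
  have ea := hcon ⟨_, a2⟩ a1 a3 a4
  have eb := hcon ⟨_, b2⟩ b1 b3 b4
  have := hf.face_unique (s := r) (t := ⟨_, a2⟩) (t' := ⟨_, b2⟩) ⟨a3, a4, ea⟩ ⟨b3, b4, eb⟩
  have h3 : r.1.erase a = r.1.erase b := congrArg Subtype.val this
  have : b ∈ r.1.erase a := Finset.mem_erase.2 ⟨hab.symm, hb.1⟩
  rw [h3] at this
  exact Finset.notMem_erase _ _ this

/-- Descend from `r` through facets of smaller value until the codimension is one. Hence a simplex
that enters as a face of another one already enters through a coface of codimension one. -/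
theorem IsDiscreteMorse.exists_coface (hf : IsDiscreteMorse f) {s r : K} (hsr : s.1 ⊂ r.1) :
    ∃ t : K, s.1 ⊂ t.1 ∧ t.1 ⊆ r.1 ∧ t.1.card = s.1.card + 1 ∧ f t ≤ f r := by
  induction hn : r.1.card using Nat.strong_induction_on generalizing r with
  | _ n ih =>
    have hlt := Finset.card_lt_card hsr
    by_cases h1 : r.1.card = s.1.card + 1
    · exact ⟨r, hsr, Finset.Subset.refl _, h1, le_rfl⟩
    · obtain ⟨t, h2, h3, h4, h5⟩ := hf.exists_facet hsr (by omega)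
      obtain ⟨t', g1, g2, g3, g4⟩ := ih t.1.card (by omega) h2 rfl
      exact ⟨t', g1, g2.trans h3.1, g3, g4.trans h5.le⟩

theorem le_of_notMem_strictSublevel {s t : K} (hs : s.1 ∉ strictSublevel f c) (hst : s.1 ⊆ t.1) :
    c ≤ f t :=
  not_lt.1 fun h => hs ⟨nonempty_of_mem s.2, t, h, hst⟩

/-- All cofaces of a new simplex `s` have value at least `c`. If `s` enters as a proper face of `r`,
some codimension-one coface has value at most `c ≤ f s`, so it is exceptional, with value exactly
`c`. -/
theorem IsDiscreteMorse.level_cases (hf : IsDiscreteMorse f) {s : K} (hs : s.1 ∈ sublevel f c)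
    (hs' : s.1 ∉ strictSublevel f c) :
    (IsCritical f s ∧ f s = c) ∨ (∃ υ ∈ exceptionalFaces f s, f s = c) ∨
      ∃ τ ∈ exceptionalCofaces f s, f τ = c := by
  obtain ⟨-, r, hr, hsr⟩ := hs
  have hcs := le_of_notMem_strictSublevel hs' (Finset.Subset.refl s.1)
  by_cases h : ∃ τ, τ ∈ exceptionalCofaces f s ∧ f τ ≤ c
  · obtain ⟨τ, hτ, hτc⟩ := h
    exact .inr (.inr ⟨τ, hτ, hτc.antisymm (le_of_notMem_strictSublevel hs' hτ.1.1)⟩)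
  push Not at h
  have hrs : s = r := by
    by_contra hne
    obtain ⟨t, h1, -, h3, h4⟩ := hf.exists_coface
      (Finset.ssubset_iff_subset_ne.2 ⟨hsr, fun e => hne (Subtype.ext e)⟩)
    exact absurd (h t ⟨h1, h3, (h4.trans hr).trans hcs⟩) (not_lt.2 (h4.trans hr))
  subst hrs
  have hsc := hr.antisymm hcs
  by_cases h' : ∃ υ, υ ∈ exceptionalFaces f s
  · obtain ⟨υ, hυ⟩ := h'
    exact .inr (.inl ⟨υ, hυ, hsc⟩)
  · refine .inl ⟨⟨?_, ?_⟩, hsc⟩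
    · rw [Set.encard_eq_zero, Set.eq_empty_iff_forall_notMem]
      intro τ hτ
      exact absurd (h τ hτ) (not_lt.2 (hτ.2.2.trans hr))
    · rw [Set.encard_eq_zero, Set.eq_empty_iff_forall_notMem]
      exact fun υ hυ => h' ⟨υ, hυ⟩

/-- A new simplex thus has at most one codimension-one coface in K(c). In the last case of
`level_cases` for `t`, another facet of `τ` through `s` would have value below `c` and make `s` old.
-/
theorem IsDiscreteMorse.mem_exceptionalCofaces (hf : IsDiscreteMorse f) {s t : K}
    (hs : s.1 ∉ strictSublevel f c) (ht : t.1 ∈ sublevel f c) (hst : s.1 ⊂ t.1)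
    (hcard : t.1.card = s.1.card + 1) : t ∈ exceptionalCofaces f s := by
  have ht' : t.1 ∉ strictSublevel f c := fun h =>
    hs (mem_of_subset h hst.1 (nonempty_of_mem s.2))
  have hcs := le_of_notMem_strictSublevel hs (Finset.Subset.refl s.1)
  rcases hf.level_cases ht ht' with h | ⟨_, _, h⟩ | ⟨τ, hτ, h⟩
  · exact ⟨hst, hcard, h.2.trans_le hcs⟩
  · exact ⟨hst, hcard, h.trans_le hcs⟩
  · obtain ⟨t', h1, -, -, h4⟩ := hf.exists_facet (hst.trans hτ.1) (by have := hτ.2.1; omega)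
    exact absurd (h4.trans_eq h) (not_lt.2 (le_of_notMem_strictSublevel hs h1.1))

theorem IsDiscreteMorse.notMem_strictSublevel (hf : IsDiscreteMorse f) {s : K}
    (h : ∀ t ∈ exceptionalCofaces f s, c ≤ f t) (hs : c ≤ f s) : s.1 ∉ strictSublevel f c := by
  rintro ⟨-, r, hr, hsr⟩
  have hne : s.1 ≠ r.1 := fun e => by
    rw [Subtype.ext e] at hs; exact absurd hr (not_lt.2 hs)
  obtain ⟨t, h1, -, h3, h4⟩ := hf.exists_coface (Finset.ssubset_iff_subset_ne.2 ⟨hsr, hne⟩)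
  exact absurd (h t ⟨h1, h3, (h4.trans hr.le).trans hs⟩) (not_le.2 (h4.trans_lt hr))

theorem IsDiscreteMorse.critical_notMem (hf : IsDiscreteMorse f) {s : K} (hs : IsCritical f s) :
    s.1 ∉ strictSublevel f (f s) :=
  hf.notMem_strictSublevel (fun t ht => absurd ht (hs.notMem_coface t)) le_rfl

/-- The two members of an exceptional pair enter together, at the value of the coface: the only
exceptional coface of `s` is `t` itself. -/
theorem IsDiscreteMorse.exceptionalFace_notMem (hf : IsDiscreteMorse f) {s t : K}
    (hs : s ∈ exceptionalFaces f t) : s.1 ∉ strictSublevel f (f t) :=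
  hf.notMem_strictSublevel (fun t' ht' => by
    rw [hf.coface_unique ht' ⟨hs.1, hs.2.1.symm, hs.2.2⟩]) hs.2.2

theorem IsDiscreteMorse.facet_mem (hf : IsDiscreteMorse f) {s s' t : K}
    (hs : s ∈ exceptionalFaces f t) (hs' : s'.1 ⊂ t.1) (hcard : s'.1.card + 1 = t.1.card)
    (hne : s' ≠ s) : s'.1 ∈ strictSublevel f (f t) :=
  mem_strictSublevel_of_lt (not_le.1 fun h => hne (hf.face_unique ⟨hs', hcard, h⟩ hs))

theorem IsCritical.facet_mem {s t : K} (ht : IsCritical f t)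
    (hs : s.1 ⊂ t.1) (hcard : s.1.card + 1 = t.1.card) : s.1 ∈ strictSublevel f (f t) :=
  mem_strictSublevel_of_lt (not_le.1 fun h => ht.notMem_face s ⟨hs, hcard, h⟩)

theorem strictSublevel_le (f : K → ℝ) (c : ℝ) : strictSublevel f c ≤ K :=
  (strictSublevel_le_sublevel f le_rfl).trans (sublevel_le f c)

theorem IsExcellent.inter_preimage_eq_singleton (hexc : IsExcellent f) {S : Set K}
    (hS : ∀ s ∈ S, IsCritical f s) {s : K} (hs : s ∈ S) : S ∩ f ⁻¹' {f s} = {s} := by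
  ext t
  refine ⟨fun ht => hexc (hS t ht.1) (hS s hs) ht.2, ?_⟩
  rintro rfl
  exact ⟨hs, rfl⟩

end Levels

/-! ### The simplicial boundary operator -/

section Boundary

variable {ι : Type*} {F : Type*} [Field F]

theorem mem_chains {K : PreAbstractSimplicialComplex ι} {q : ℕ} {w : Finset ι →₀ F} :
    w ∈ chains F K q ↔ ∀ s, w s ≠ 0 → s ∈ K ∧ s.card = q + 1 := by
  simp [chains, Finsupp.mem_supported, Set.subset_def]

theorem single_mem_chains {K : PreAbstractSimplicialComplex ι} {q : ℕ} {s : Finset ι} (a : F)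
    (hs : s ∈ K) (hq : s.card = q + 1) : Finsupp.single s a ∈ chains F K q :=
  Finsupp.single_mem_supported F a ⟨hs, hq⟩

variable (F) in
theorem finiteDimensional_chains {K L : PreAbstractSimplicialComplex ι} (hK : (K : Set (Finset ι)).Finite)
    (hL : L ≤ K) (q : ℕ) : FiniteDimensional F (chains F L q) := by
  have hfin : {σ | σ ∈ L ∧ σ.card = q + 1}.Finite := hK.subset fun s hs => hL hs.1
  have := hfin.to_subtype
  exact Module.Finite.equiv (Finsupp.supportedEquivFinsupp {σ | σ ∈ L ∧ σ.card = q + 1}).symm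

variable [LinearOrder ι]

theorem boundary_single (s : Finset ι) (a : F) :
    boundary F (Finsupp.single s a) = a • simplexBoundary F s := by
  simp [boundary]

theorem simplexBoundary_of_facet_ne_zero {s t : Finset ι} (hst : s ⊂ t)
    (hcard : s.card + 1 = t.card) (hs : s.Nonempty) : simplexBoundary F t s ≠ 0 := by
  obtain ⟨v, hv, rfl⟩ : ∃ v ∈ t, s = t.erase v := by
    obtain ⟨v, hv, hvs⟩ := Finset.exists_of_ssubset hst
    refine ⟨v, hv, Finset.eq_of_subset_of_card_le (Finset.subset_erase.2 ⟨hst.1, hvs⟩) ?_⟩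
    rw [Finset.card_erase_of_mem hv]; omega
  have h1 : ¬ t.card ≤ 1 := by have := hs.card_pos; omega
  rw [simplexBoundary, if_neg h1, Finsupp.finsetSum_apply, Finset.sum_eq_single v]
  · simp
  · intro w hw hwv
    rw [Finsupp.single_apply, if_neg]
    intro h
    have : v ∈ t.erase w := Finset.mem_erase.2 ⟨hwv.symm, hv⟩
    rw [h] at this
    exact Finset.notMem_erase _ _ this
  · exact fun h => absurd hv h

theorem facet_of_simplexBoundary_ne_zero {s t : Finset ι} (h : simplexBoundary F t s ≠ 0) :
    s ⊂ t ∧ s.card + 1 = t.card ∧ s.Nonempty := by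
  rw [simplexBoundary] at h
  split_ifs at h with h1
  · simp at h
  · rw [Finsupp.finsetSum_apply] at h
    obtain ⟨v, hv, hvs⟩ := Finset.exists_ne_zero_of_sum_ne_zero h
    rw [Finsupp.single_apply] at hvs
    split_ifs at hvs with h2
    · subst h2
      have := Finset.card_erase_add_one hv
      exact ⟨Finset.erase_ssubset hv, this, Finset.card_pos.1 (by omega)⟩
    · simp at hvs

theorem boundary_apply (w : Finset ι →₀ F) (s : Finset ι) :
    boundary F w s = ∑ t ∈ w.support, w t * simplexBoundary F t s := by
  simp [boundary, Finsupp.linearCombination_apply, Finsupp.sum, Finsupp.finsetSum_apply]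

theorem exists_coface_of_boundary_ne_zero {w : Finset ι →₀ F} {s : Finset ι}
    (h : boundary F w s ≠ 0) :
    ∃ t, w t ≠ 0 ∧ s ⊂ t ∧ s.card + 1 = t.card ∧ s.Nonempty := by
  rw [boundary_apply] at h
  obtain ⟨t, -, ht⟩ := Finset.exists_ne_zero_of_sum_ne_zero h
  exact ⟨t, left_ne_zero_of_mul ht, facet_of_simplexBoundary_ne_zero (right_ne_zero_of_mul ht)⟩

theorem boundary_mem_chains {K : PreAbstractSimplicialComplex ι} {q : ℕ} {w : Finset ι →₀ F}
    (hw : w ∈ chains F K (q + 1)) : boundary F w ∈ chains F K q := by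
  rw [mem_chains] at hw ⊢
  intro s hs
  obtain ⟨t, h1, h2, h3, h4⟩ := exists_coface_of_boundary_ne_zero hs
  obtain ⟨h5, h6⟩ := hw t h1
  exact ⟨mem_of_subset h5 h2.1 h4, by omega⟩

theorem boundary_eq_zero_of_mem_chains_zero {K : PreAbstractSimplicialComplex ι}
    {w : Finset ι →₀ F} (hw : w ∈ chains F K 0) : boundary F w = 0 := by
  ext s
  by_contra hs
  obtain ⟨t, h1, h2, h3, h4⟩ := exists_coface_of_boundary_ne_zero hs
  have := (mem_chains.1 hw t h1).2
  have := h4.card_pos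
  omega

theorem card_filter_lt_erase_of_lt {t : Finset ι} {v w : ι} (h : w < v) :
    ((t.erase v).filter (· < w)).card = (t.filter (· < w)).card := by
  congr 1
  ext x
  simp only [Finset.mem_filter, Finset.mem_erase]
  exact ⟨fun hx => ⟨hx.1.2, hx.2⟩, fun hx => ⟨⟨(hx.2.trans h).ne, hx.1⟩, hx.2⟩⟩

theorem card_filter_lt_erase_of_gt {t : Finset ι} {v w : ι} (h : w < v) (hw : w ∈ t) :
    ((t.erase w).filter (· < v)).card + 1 = (t.filter (· < v)).card := by
  have : (t.erase w).filter (· < v) = (t.filter (· < v)).erase w := by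
    ext x
    simp only [Finset.mem_filter, Finset.mem_erase, and_assoc]
  rw [this, Finset.card_erase_add_one (Finset.mem_filter.2 ⟨hw, h⟩)]

theorem boundary_simplexBoundary (t : Finset ι) : boundary F (simplexBoundary F t) = 0 := by
  by_cases h1 : t.card ≤ 1
  · simp [simplexBoundary, h1]
  -- Edges are separate: their facets are vertices, whose boundary is zero by convention rather than
  -- a multiple of the empty simplex.
  by_cases h2 : t.card ≤ 2
  · rw [simplexBoundary, if_neg h1, map_sum]
    refine Finset.sum_eq_zero fun v hv => ?_
    rw [boundary_single, simplexBoundary, if_pos, smul_zero]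
    rw [Finset.card_erase_of_mem hv]; omega
  have key : ∀ v ∈ t, boundary F (Finsupp.single (t.erase v)
      ((-1 : F) ^ (t.filter (fun w => w < v)).card)) =
      ∑ w ∈ t.erase v, Finsupp.single ((t.erase v).erase w)
        ((-1 : F) ^ ((t.filter (· < v)).card + ((t.erase v).filter (· < w)).card)) := by
    intro v hv
    rw [boundary_single, simplexBoundary, if_neg, Finset.smul_sum]
    · simp [pow_add]
    · rw [Finset.card_erase_of_mem hv]; omega
  rw [simplexBoundary, if_neg h1, map_sum, Finset.sum_congr rfl key, Finset.sum_sigma']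
  -- Removing `v` then `w` cancels against `w` then `v`: deleting the smaller vertex first lowers
  -- the position of the larger by one, while the other order changes nothing.
  refine Finset.sum_involution (fun p _ => ⟨p.2, p.1⟩) ?_ ?_ ?_ ?_
  · rintro ⟨v, w⟩ hp
    simp only [Finset.mem_sigma, Finset.mem_erase] at hp
    obtain ⟨hv, hwv, hw⟩ := hp
    dsimp only
    rw [Finset.erase_right_comm, ← Finsupp.single_add, Finsupp.single_eq_zero]
    rcases lt_or_gt_of_ne hwv with h | h
    · rw [card_filter_lt_erase_of_lt h, ← card_filter_lt_erase_of_gt h hw]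
      ring
    · rw [card_filter_lt_erase_of_lt h, ← card_filter_lt_erase_of_gt h hv]
      ring
  · rintro ⟨v, w⟩ hp _ h
    simp only [Finset.mem_sigma, Finset.mem_erase] at hp
    exact hp.2.1 (congrArg Sigma.fst h)
  · rintro ⟨v, w⟩ hp
    simp only [Finset.mem_sigma, Finset.mem_erase] at hp ⊢
    exact ⟨hp.2.2, hp.2.1.symm, hp.1⟩
  · exact fun _ _ => rfl

theorem boundary_boundary (w : Finset ι →₀ F) : boundary F (boundary F w) = 0 := by
  have : (boundary F : (Finset ι →₀ F) →ₗ[F] _) ∘ₗ boundary F = 0 := by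
    refine Finsupp.lhom_ext fun s a => ?_
    simp [boundary_single, boundary_simplexBoundary]
  exact LinearMap.congr_fun this w

theorem boundaries_le_cycles (K : PreAbstractSimplicialComplex ι) (q : ℕ) :
    boundaries F K q ≤ cycles F K q := by
  rintro _ ⟨w, hw, rfl⟩
  exact ⟨boundary_mem_chains hw, boundary_boundary w⟩

end Boundary

/-! ### Elimination of exceptional pairs in relative chains -/

section Relative

variable {ι : Type*} [LinearOrder ι] {F : Type*} [Field F] {K : PreAbstractSimplicialComplex ι}
  {f : K → ℝ} {c : ℝ}

/-- The coefficient of the boundary of a chain of `K(c)` at a simplex outside of `K(c⁻)` only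
involves its exceptional coface. -/
theorem IsDiscreteMorse.boundary_apply_of_notMem (hf : IsDiscreteMorse f) {q : ℕ}
    {w : Finset ι →₀ F} (hw : w ∈ chains F (sublevel f c) q) {s : K}
    (hs : s.1 ∉ strictSublevel f c) (h : boundary F w s.1 ≠ 0) :
    ∃ t ∈ exceptionalCofaces f s, w t.1 ≠ 0 := by
  obtain ⟨t, h1, h2, h3, h4⟩ := exists_coface_of_boundary_ne_zero h
  have ht := (mem_chains.1 hw t h1).1
  exact ⟨⟨t, sublevel_le f c ht⟩, hf.mem_exceptionalCofaces hs ht h2 h3.symm, h1⟩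

theorem IsDiscreteMorse.boundary_apply_critical (hf : IsDiscreteMorse f) {q : ℕ} {s : K}
    (hs : IsCritical f s) {w : Finset ι →₀ F} (hw : w ∈ chains F (sublevel f (f s)) q) :
    boundary F w s.1 = 0 := by
  by_contra h
  obtain ⟨t, ht, -⟩ := hf.boundary_apply_of_notMem hw (hf.critical_notMem hs) h
  exact hs.notMem_coface t ht

theorem IsDiscreteMorse.boundary_apply_exceptionalFace (hf : IsDiscreteMorse f) {q : ℕ}
    {w : Finset ι →₀ F} {s t : K} (hw : w ∈ chains F (sublevel f (f t)) q)
    (hs : s ∈ exceptionalFaces f t) : boundary F w s.1 = w t.1 * simplexBoundary F t.1 s.1 := by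
  rw [boundary_apply]
  refine Finset.sum_eq_single t.1 (fun t' ht' hne => ?_) (fun h => ?_)
  · by_contra h
    obtain ⟨h1, h2, -⟩ := facet_of_simplexBoundary_ne_zero (right_ne_zero_of_mul h)
    have hm := (mem_chains.1 hw t' (Finsupp.mem_support_iff.1 ht')).1
    have h3 := hf.mem_exceptionalCofaces (t := ⟨t', sublevel_le f _ hm⟩)
      (hf.exceptionalFace_notMem hs) hm h1 h2.symm
    exact hne (congrArg Subtype.val (hf.coface_unique h3 ⟨hs.1, hs.2.1.symm, hs.2.2⟩))
  · rw [Finsupp.notMem_support_iff.1 h, zero_mul]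

/-- Relative chains of `(K(c), K(c⁻))` with relative boundary zero are homologous to combinations
of critical simplices. -/
theorem IsDiscreteMorse.exists_sub_boundary (hf : IsDiscreteMorse f) {q : ℕ} (w : Finset ι →₀ F)
    (hw : w ∈ chains F (sublevel f c) q)
    (hb : ∀ s, boundary F w s ≠ 0 → s ∈ strictSublevel f c) :
    ∃ u ∈ chains F (sublevel f c) (q + 1), ∀ s : K, (w - boundary F u) s.1 ≠ 0 →
      s.1 ∈ strictSublevel f c ∨ (IsCritical f s ∧ f s = c) := by
  classical
  induction hn : (w.support.filter fun s => s ∉ strictSublevel f c).card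
    using Nat.strong_induction_on generalizing w with
  | _ n ih =>
  by_cases hdone : ∀ s : K, w s.1 ≠ 0 → s.1 ∈ strictSublevel f c ∨ (IsCritical f s ∧ f s = c)
  · exact ⟨0, zero_mem _, by simpa using hdone⟩
  push Not at hdone
  obtain ⟨s, hs, hsL, hcrit⟩ := hdone
  have hsM := mem_chains.1 hw _ hs
  rcases hf.level_cases hsM.1 hsL with h | ⟨υ, hυ, h⟩ | ⟨τ, hτ, h⟩
  · exact absurd h.2 (hcrit h.1)
  · subst h
    -- No other simplex of K(c) can cancel the contribution of `s` to the coefficient at the new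
    -- simplex `υ`, so the boundary would not be old.
    refine absurd (hb υ.1 ?_) (hf.exceptionalFace_notMem hυ)
    rw [hf.boundary_apply_exceptionalFace hw hυ]
    exact mul_ne_zero hs
      (simplexBoundary_of_facet_ne_zero hυ.1 hυ.2.1 (nonempty_of_mem υ.2))
  · subst h
    have hsτ : s ∈ exceptionalFaces f τ := ⟨hτ.1, hτ.2.1.symm, hτ.2.2⟩
    have hne := simplexBoundary_of_facet_ne_zero (F := F) hτ.1 hτ.2.1.symm (nonempty_of_mem s.2)
    set e := simplexBoundary F τ.1 s.1
    -- The coefficient is chosen so that ∂v cancels `s` in `w`. The other facets of `τ` are old, so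
    -- the number of new simplices in the support drops.
    set v : Finset ι →₀ F := Finsupp.single τ.1 (w s.1 / e) with hv
    have hvM : v ∈ chains F (sublevel f (f τ)) (q + 1) :=
      single_mem_chains _ (mem_sublevel_of_le le_rfl) (by rw [hτ.2.1, hsM.2])
    have hvb : boundary F v = (w s.1 / e) • simplexBoundary F τ.1 := boundary_single _ _
    have hs0 : (w - boundary F v) s.1 = 0 := by
      rw [hvb]
      simp only [Finsupp.sub_apply, Finsupp.smul_apply, smul_eq_mul]
      rw [div_mul_cancel₀ _ hne, sub_self]
    have hsupp : ∀ t, (w - boundary F v) t ≠ 0 → t ∉ strictSublevel f (f τ) → w t ≠ 0 := by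
      intro t ht htL hwt
      have ht' : simplexBoundary F τ.1 t ≠ 0 := by
        intro h0
        apply ht
        rw [hvb]
        simp [hwt, h0]
      obtain ⟨h1, h2, h3⟩ := facet_of_simplexBoundary_ne_zero ht'
      refine htL (hf.facet_mem (s' := ⟨t, mem_of_subset τ.2 h1.1 h3⟩) hsτ h1 h2 ?_)
      rintro rfl
      exact ht hs0
    obtain ⟨u, hu, hu'⟩ := ih _ (by
      rw [← hn]
      refine Finset.card_lt_card (Finset.ssubset_iff_of_subset ?_ |>.2 ⟨s.1, ?_, ?_⟩)
      · intro t ht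
        simp only [Finset.mem_filter, Finsupp.mem_support_iff] at ht ⊢
        exact ⟨hsupp t ht.1 ht.2, ht.2⟩
      · simpa using ⟨hs, hsL⟩
      · simp only [Finset.mem_filter, Finsupp.mem_support_iff]
        exact fun h => h.1 hs0) (w - boundary F v) (sub_mem hw (boundary_mem_chains hvM))
      (by rwa [map_sub, boundary_boundary, sub_zero]) rfl
    exact ⟨v + u, add_mem hvM hu, by rwa [map_add, ← sub_sub]⟩

end Relative

/-! ### Dimension counts -/

section Dimension

variable {F E : Type*} [Field F] [AddCommGroup E] [Module F E]

theorem finrank_sup_span_singleton_of_notMem {W : Submodule F E} [FiniteDimensional F W] {v : E}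
    (hv : v ∉ W) :
    Module.finrank F (W ⊔ Submodule.span F {v} : Submodule F E) = Module.finrank F W + 1 := by
  have hv0 : v ≠ 0 := fun h => hv (h ▸ zero_mem W)
  have h := Submodule.finrank_sup_add_finrank_inf_eq W (Submodule.span F {v})
  rwa [((Submodule.disjoint_span_singleton' hv0).2 hv).eq_bot, finrank_bot, add_zero,
    finrank_span_singleton hv0] at h

theorem finrank_subquotient {Z B : Submodule F E} [FiniteDimensional F Z] (h : B ≤ Z) :
    Module.finrank F (Subquotient Z B) + Module.finrank F B = Module.finrank F Z := by
  rw [← (Submodule.submoduleOfEquivOfLe h).finrank_eq]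
  exact Submodule.finrank_quotient_add_finrank (B.submoduleOf Z)

end Dimension

/-! ### Change of the Betti numbers at one level -/

section Step

variable {ι : Type*} [LinearOrder ι] (F : Type*) [Field F] {K : PreAbstractSimplicialComplex ι}
  {f : K → ℝ} {c : ℝ}

theorem finiteDimensional_cycles (hK : (K : Set (Finset ι)).Finite) {L : PreAbstractSimplicialComplex ι}
    (hL : L ≤ K) (q : ℕ) : FiniteDimensional F (cycles F L q) :=
  have := finiteDimensional_chains F hK hL q
  Submodule.finiteDimensional_of_le inf_le_left

theorem finiteDimensional_boundaries (hK : (K : Set (Finset ι)).Finite)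
    {L : PreAbstractSimplicialComplex ι} (hL : L ≤ K) (q : ℕ) :
    FiniteDimensional F (boundaries F L q) :=
  have := finiteDimensional_cycles F hK hL q
  Submodule.finiteDimensional_of_le (boundaries_le_cycles L q)

theorem betti_add_finrank (hK : (K : Set (Finset ι)).Finite) {L : PreAbstractSimplicialComplex ι}
    (hL : L ≤ K) (q : ℕ) :
    betti F L q + Module.finrank F (boundaries F L q) = Module.finrank F (cycles F L q) :=
  have := finiteDimensional_cycles F hK hL q
  finrank_subquotient (boundaries_le_cycles L q)

/-- A critical simplex creates a homology class if its boundary already bounds in the preceding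
complex. -/
def IsCreator (f : K → ℝ) (s : K) : Prop :=
  boundary F (Finsupp.single s.1 1) ∈
    (chains F (strictSublevel f (f s)) (s.1.card - 1)).map (boundary F)

/-- The critical simplices of dimension `q` that create a homology class. -/
def creators (f : K → ℝ) (q : ℕ) : Set K :=
  {s | IsCritical f s ∧ s.1.card = q + 1 ∧ IsCreator F f s}

/-- The critical simplices of dimension `q` that destroy a homology class. -/
def destroyers (f : K → ℝ) (q : ℕ) : Set K :=
  {s | IsCritical f s ∧ s.1.card = q + 1 ∧ ¬ IsCreator F f s}

variable {F}

theorem isCreator_iff {q : ℕ} {s : K} (hs : s.1.card = q + 2) :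
    IsCreator F f s ↔
      boundary F (Finsupp.single s.1 1) ∈ boundaries F (strictSublevel f (f s)) q := by
  rw [IsCreator, hs]; rfl

theorem IsDiscreteMorse.exists_decomposition (hf : IsDiscreteMorse f) {q : ℕ} {w : Finset ι →₀ F}
    (hw : w ∈ chains F (sublevel f c) q)
    (hb : boundary F w = 0 ∨ boundary F w ∈ chains F (strictSublevel f c) (q - 1))
    (hexc : IsExcellent f) :
    ∃ u ∈ chains F (sublevel f c) (q + 1), ∃ l ∈ chains F (strictSublevel f c) q,
      w = boundary F u + l ∨ ∃ s : K, IsCritical f s ∧ f s = c ∧ s.1.card = q + 1 ∧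
        ∃ a : F, a ≠ 0 ∧ w = boundary F u + l + Finsupp.single s.1 a := by
  obtain ⟨u, hu, hu'⟩ := hf.exists_sub_boundary w hw (fun s hs => by
    rcases hb with h | h
    · exact absurd (by rw [h]; rfl) hs
    · exact (mem_chains.1 h s hs).1)
  have hM : w - boundary F u ∈ chains F (sublevel f c) q := sub_mem hw (boundary_mem_chains hu)
  refine ⟨u, hu, ?_⟩
  by_cases h : w - boundary F u ∈ chains F (strictSublevel f c) q
  · exact ⟨_, h, .inl (by abel)⟩
  rw [mem_chains] at h hM
  push Not at h
  obtain ⟨s, hs, h⟩ := h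
  obtain ⟨hsM, hcard⟩ := hM s hs
  have hsL : s ∉ strictSublevel f c := fun h' => h h' hcard
  obtain ⟨hcrit, hsc⟩ := (hu' ⟨s, sublevel_le f c hsM⟩ hs).resolve_left hsL
  refine ⟨w - boundary F u - Finsupp.single s ((w - boundary F u) s), ?_,
    .inr ⟨⟨s, sublevel_le f c hsM⟩, hcrit, hsc, hcard, _, hs, by abel⟩⟩
  rw [mem_chains]
  intro t ht
  have hts : t ≠ s := by
    rintro rfl
    simp at ht
  have ht' : (w - boundary F u) t ≠ 0 := by
    rwa [Finsupp.sub_apply, Finsupp.single_apply, if_neg hts.symm, sub_zero] at ht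
  obtain ⟨htM, htc⟩ := hM t ht'
  refine ⟨(hu' ⟨t, sublevel_le f c htM⟩ ht').resolve_right fun hh => hts ?_, htc⟩
  exact congrArg Subtype.val (hexc hh.1 hcrit (hh.2.trans hsc.symm))

theorem boundary_single_mem_chains {q : ℕ} {s : K} (hs : IsCritical f s)
    (hcard : s.1.card = q + 2) :
    boundary F (Finsupp.single s.1 (1 : F)) ∈ chains F (strictSublevel f (f s)) q := by
  rw [boundary_single, one_smul, mem_chains]
  intro t ht
  obtain ⟨h1, h2, h3⟩ := facet_of_simplexBoundary_ne_zero ht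
  exact ⟨hs.facet_mem (s := ⟨t, mem_of_subset s.2 h1.1 h3⟩) h1 h2, by omega⟩

/-- The coefficient at `s` therefore detects genuinely new classes: old cycles do not contain `s`,
and `s` has no coface in K(f s) that could put it in a boundary. -/
theorem apply_eq_zero_of_mem_sup (hf : IsDiscreteMorse f) {q : ℕ} {s : K} (hs : IsCritical f s)
    {z : Finset ι →₀ F}
    (hz : z ∈ cycles F (strictSublevel f (f s)) q ⊔ boundaries F (sublevel f (f s)) q) :
    z s.1 = 0 := by
  obtain ⟨l, hl, _, ⟨u, hu, rfl⟩, rfl⟩ := Submodule.mem_sup.1 hz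
  rw [Finsupp.add_apply, hf.boundary_apply_critical hs hu, add_zero]
  by_contra h
  exact hf.critical_notMem hs (mem_chains.1 hl.1 _ h).1

/-- New cycles, modulo new boundaries, come from a creator. -/
theorem exists_creator_of_cycle (hf : IsDiscreteMorse f) (hexc : IsExcellent f) {q : ℕ}
    {z : Finset ι →₀ F} (hz : z ∈ cycles F (sublevel f c) q)
    (hz' : z ∉ cycles F (strictSublevel f c) q ⊔ boundaries F (sublevel f c) q) :
    ∃ s ∈ creators F f q, f s = c ∧ z s.1 ≠ 0 := by
  obtain ⟨u, hu, l, hl, h⟩ := hf.exists_decomposition hz.1 (.inl hz.2) hexc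
  have hz0 : boundary F z = 0 := hz.2
  rcases h with rfl | ⟨s, hs, rfl, hcard, a, ha, rfl⟩
  · refine absurd (add_comm _ l ▸ Submodule.add_mem_sup ⟨hl, ?_⟩ ⟨u, hu, rfl⟩) hz'
    simpa [boundary_boundary] using hz0
  -- Since ∂z = 0, one has ∂l = -a ∂s, so this multiple of `l` is an old chain with boundary ∂s.
  · refine ⟨s, ⟨hs, hcard, -a⁻¹ • l, ?_, ?_⟩, rfl, ?_⟩
    · rw [hcard]; exact Submodule.smul_mem _ _ hl
    · rw [map_add, map_add, boundary_boundary, zero_add, ← eq_neg_iff_add_eq_zero] at hz0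
      rw [map_smul, hz0, ← map_neg, ← map_smul]
      simp [ha]
    · have hls : l s.1 = 0 := by
        by_contra h
        exact hf.critical_notMem hs (mem_chains.1 hl _ h).1
      simpa [hls, hf.boundary_apply_critical hs hu] using ha

/-- New boundaries among the old cycles come from a destroyer. -/
theorem exists_destroyer_of_boundary (hf : IsDiscreteMorse f) (hexc : IsExcellent f) {q : ℕ}
    {z : Finset ι →₀ F} (hz : z ∈ cycles F (strictSublevel f c) q)
    (hzM : z ∈ boundaries F (sublevel f c) q) (hzL : z ∉ boundaries F (strictSublevel f c) q) :
    ∃ s ∈ destroyers F f (q + 1), f s = c ∧ ∃ a : F, a ≠ 0 ∧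
      z - a • boundary F (Finsupp.single s.1 1) ∈ boundaries F (strictSublevel f c) q := by
  obtain ⟨w, hw, rfl⟩ := hzM
  obtain ⟨u, hu, l, hl, h⟩ := hf.exists_decomposition hw (.inr hz.1) hexc
  have hlb : boundary F l ∈ boundaries F (strictSublevel f c) q := ⟨l, hl, rfl⟩
  rcases h with rfl | ⟨s, hs, rfl, hcard, a, ha, rfl⟩
  · rw [map_add, boundary_boundary, zero_add] at hzL
    exact absurd hlb hzL
  · have hsplit : boundary F (Finsupp.single s.1 a) = a • boundary F (Finsupp.single s.1 1) := by
      rw [← map_smul]; simp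
    rw [map_add, map_add, boundary_boundary, zero_add, hsplit] at hzL ⊢
    refine ⟨s, ⟨hs, hcard, fun h => hzL ?_⟩, rfl, a, ha, by simpa using hlb⟩
    exact add_mem hlb (Submodule.smul_mem _ _ ((isCreator_iff hcard).1 h))

/-- This computes the cokernel of H_q(K(c⁻)) → H_q(K(c)). It is spanned by the class of s - l, where
`s` is the creator at `c`, if any, and `l` is an old chain with ∂l = ∂s. -/
theorem finrank_cycles_sublevel (hK : (K : Set (Finset ι)).Finite) (hf : IsDiscreteMorse f)
    (hexc : IsExcellent f) (c : ℝ) (q : ℕ) :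
    Module.finrank F (cycles F (sublevel f c) q) =
      Module.finrank F (cycles F (strictSublevel f c) q ⊔ boundaries F (sublevel f c) q :
        Submodule F (Finset ι →₀ F)) + (creators F f q ∩ f ⁻¹' {c}).ncard := by
  have := finiteDimensional_cycles F hK (strictSublevel_le f c) q
  have := finiteDimensional_boundaries F hK (sublevel_le f c) q
  have hle : cycles F (strictSublevel f c) q ⊔ boundaries F (sublevel f c) q ≤
      cycles F (sublevel f c) q :=
    sup_le (cycles_mono F (strictSublevel_le_sublevel f le_rfl) q) (boundaries_le_cycles _ q)
  by_cases h : ∃ s ∈ creators F f q, f s = c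
  · obtain ⟨s, hs, rfl⟩ := h
    rw [hexc.inter_preimage_eq_singleton (fun t ht => ht.1) hs, Set.ncard_singleton]
    obtain ⟨hcrit, hcard, l, hl, hlb⟩ := hs
    rw [hcard] at hl
    set z := Finsupp.single s.1 (1 : F) - l with hz
    have hzs : z s.1 = 1 := by
      have : l s.1 = 0 := by
        by_contra h
        exact hf.critical_notMem hcrit (mem_chains.1 hl _ h).1
      simp [hz, this]
    have hzc : z ∈ cycles F (sublevel f (f s)) q :=
      ⟨sub_mem (single_mem_chains _ (mem_sublevel_of_le le_rfl) hcard)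
        (chains_mono F (strictSublevel_le_sublevel f le_rfl) q hl),
        LinearMap.mem_ker.2 (by rw [map_sub, hlb, sub_self])⟩
    rw [← finrank_sup_span_singleton_of_notMem (v := z)]
    · refine congrArg (fun W : Submodule F (Finset ι →₀ F) => Module.finrank F W)
        (le_antisymm (fun x hx => ?_)
        (sup_le hle ((Submodule.span_singleton_le_iff_mem _ _).2 hzc)))
      -- This difference has coefficient zero at `s`, the only creator at this level, so it cannot
      -- represent a new class.
      by_cases hx' : x - x s.1 • z ∈ cycles F (strictSublevel f (f s)) q ⊔
          boundaries F (sublevel f (f s)) q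
      · exact sub_add_cancel x (x s.1 • z) ▸ Submodule.add_mem_sup hx'
          (Submodule.smul_mem _ _ (Submodule.mem_span_singleton_self z))
      · obtain ⟨t, ht, hts, hne⟩ := exists_creator_of_cycle hf hexc
          (sub_mem hx (Submodule.smul_mem _ (x s.1) hzc)) hx'
        obtain rfl : t = s := hexc ht.1 hcrit hts
        simp [hzs] at hne
    · intro h
      rw [apply_eq_zero_of_mem_sup hf hcrit h] at hzs
      exact zero_ne_one hzs
  · rw [show creators F f q ∩ f ⁻¹' {c} = ∅ from Set.not_nonempty_iff_eq_empty.1 h, Set.ncard_empty,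
      add_zero]
    refine congrArg (fun W : Submodule F (Finset ι →₀ F) => Module.finrank F W)
      (le_antisymm (fun x hx => ?_) hle)
    by_contra hx'
    obtain ⟨s, hs, hsc, -⟩ := exists_creator_of_cycle hf hexc hx hx'
    exact h ⟨s, hs, hsc⟩

/-- This computes the kernel of H_q(K(c⁻)) → H_q(K(c)), which is spanned by the class of ∂s for the
destroyer `s` at `c`, if any. -/
theorem finrank_inf_boundaries (hK : (K : Set (Finset ι)).Finite) (hf : IsDiscreteMorse f)
    (hexc : IsExcellent f) (c : ℝ) (q : ℕ) :
    Module.finrank F (cycles F (strictSublevel f c) q ⊓ boundaries F (sublevel f c) q :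
        Submodule F (Finset ι →₀ F)) = Module.finrank F (boundaries F (strictSublevel f c) q) +
      (destroyers F f (q + 1) ∩ f ⁻¹' {c}).ncard := by
  have := finiteDimensional_boundaries F hK (strictSublevel_le f c) q
  have hle : boundaries F (strictSublevel f c) q ≤
      cycles F (strictSublevel f c) q ⊓ boundaries F (sublevel f c) q :=
    le_inf (boundaries_le_cycles _ q) (boundaries_mono F (strictSublevel_le_sublevel f le_rfl) q)
  by_cases h : ∃ s ∈ destroyers F f (q + 1), f s = c
  · obtain ⟨s, hs, rfl⟩ := h
    have hsing := hexc.inter_preimage_eq_singleton (fun t ht => ht.1) hs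
    rw [hsing, Set.ncard_singleton]
    have hnot : boundary F (Finsupp.single s.1 1) ∉ boundaries F (strictSublevel f (f s)) q :=
      fun h => hs.2.2 ((isCreator_iff hs.2.1).2 h)
    rw [← finrank_sup_span_singleton_of_notMem hnot]
    refine congrArg (fun W : Submodule F (Finset ι →₀ F) => Module.finrank F W)
      (le_antisymm (fun x hx => ?_) (sup_le hle ((Submodule.span_singleton_le_iff_mem _ _).2
      ⟨⟨boundary_single_mem_chains hs.1 hs.2.1, boundary_boundary _⟩, _,
        single_mem_chains 1 (mem_sublevel_of_le le_rfl) hs.2.1, rfl⟩)))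
    by_cases hx' : x ∈ boundaries F (strictSublevel f (f s)) q
    · exact Submodule.mem_sup_left hx'
    · obtain ⟨t, ht, hts, a, -, ha⟩ := exists_destroyer_of_boundary hf hexc hx.1 hx.2 hx'
      obtain rfl : t = s := hexc ht.1 hs.1 hts
      exact sub_add_cancel x (a • boundary F (Finsupp.single t.1 1)) ▸ Submodule.add_mem_sup ha
          (Submodule.smul_mem _ _ (Submodule.mem_span_singleton_self _))
  · rw [show destroyers F f (q + 1) ∩ f ⁻¹' {c} = ∅ from Set.not_nonempty_iff_eq_empty.1 h, Set.ncard_empty,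
      add_zero]
    refine congrArg (fun W : Submodule F (Finset ι →₀ F) => Module.finrank F W)
      (le_antisymm (fun x hx => ?_) hle)
    by_contra hx'
    obtain ⟨s, hs, hsc, -⟩ := exists_destroyer_of_boundary hf hexc hx.1 hx.2 hx'
    exact h ⟨s, hs, hsc⟩

/-- The Betti number changes by dim coker - dim ker; the dimension formula for the sum and
intersection of old cycles and new boundaries combines the two counts. -/
theorem betti_sublevel (hK : (K : Set (Finset ι)).Finite) (hf : IsDiscreteMorse f)
    (hexc : IsExcellent f) (c : ℝ) (q : ℕ) :
    betti F (sublevel f c) q + (destroyers F f (q + 1) ∩ f ⁻¹' {c}).ncard =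
      betti F (strictSublevel f c) q + (creators F f q ∩ f ⁻¹' {c}).ncard := by
  have := finiteDimensional_cycles F hK (strictSublevel_le f c) q
  have := finiteDimensional_boundaries F hK (sublevel_le f c) q
  have h1 := betti_add_finrank F hK (sublevel_le f c) q
  have h2 := betti_add_finrank F hK (strictSublevel_le f c) q
  have h3 := finrank_cycles_sublevel (F := F) hK hf hexc c q
  have h4 := finrank_inf_boundaries (F := F) hK hf hexc c q
  have h5 := Submodule.finrank_sup_add_finrank_inf_eq (cycles F (strictSublevel f c) q)
    (boundaries F (sublevel f c) q)
  omega

end Step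

/-! ### Summation over the filtration -/

section Filtration

variable {ι : Type*} {K : PreAbstractSimplicialComplex ι} {f : K → ℝ} {c : ℝ}

theorem exists_last_value_lt (hK : (K : Set (Finset ι)).Finite) (f : K → ℝ) (c : ℝ) :
    (∀ s, c ≤ f s) ∨ ∃ s₀, f s₀ < c ∧ ∀ s, f s < c → f s ≤ f s₀ := by
  have : Finite K := hK
  rcases Set.eq_empty_or_nonempty (f ⁻¹' Set.Iio c) with h | h
  · exact .inl fun s => not_lt.1 fun hs => (h ▸ hs : s ∈ (∅ : Set K))
  · obtain ⟨s₀, h1, h2⟩ := Set.exists_max_image _ f (Set.toFinite _) h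
    exact .inr ⟨s₀, h1, h2⟩

theorem strictSublevel_eq_sublevel {s₀ : K} (h : f s₀ < c) (hmax : ∀ s, f s < c → f s ≤ f s₀) :
    strictSublevel f c = sublevel f (f s₀) :=
  le_antisymm (fun _ ht => ⟨ht.1, ht.2.imp fun _ hs => ⟨hmax _ hs.1, hs.2⟩⟩)
    (sublevel_le_strictSublevel f h)

theorem exists_strictSublevel_eq (hK : (K : Set (Finset ι)).Finite) (f : K → ℝ) :
    ∃ c, (∀ s, f s < c) ∧ strictSublevel f c = K := by
  have : Finite K := hK
  obtain ⟨b, hb⟩ := (Set.finite_range f).bddAbove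
  have h : ∀ s, f s < b + 1 := fun s => (hb ⟨s, rfl⟩).trans_lt (lt_add_one b)
  exact ⟨b + 1, h, le_antisymm (strictSublevel_le f _)
    fun s hs => mem_strictSublevel_of_lt (s := ⟨s, hs⟩) (h _)⟩

theorem ncard_inter_Iic (hK : (K : Set (Finset ι)).Finite) (f : K → ℝ) (S : Set K) (c : ℝ) :
    (S ∩ f ⁻¹' Set.Iic c).ncard = (S ∩ f ⁻¹' Set.Iio c).ncard + (S ∩ f ⁻¹' {c}).ncard := by
  have : Finite K := hK
  rw [← Set.ncard_union_eq, ← Set.inter_union_distrib_left, ← Set.preimage_union,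
    Set.Iio_union_right]
  exact Set.disjoint_left.2 fun s h1 h2 => absurd h1.2 (not_lt.2 (le_of_eq h2.2.symm))

variable [LinearOrder ι] {F : Type*} [Field F]

theorem cycles_strictSublevel_eq_bot (h : ∀ s, c ≤ f s) (q : ℕ) :
    cycles F (strictSublevel f c) q = ⊥ := by
  refine (Submodule.eq_bot_iff _).2 fun z hz => Finsupp.ext fun t => ?_
  by_contra ht
  obtain ⟨-, s, hs, -⟩ := (mem_chains.1 hz.1 t ht).1
  exact absurd hs (not_lt.2 (h s))

/-- Induction on the number of simplices of value below `c`: K(c⁻) is either empty or equal to K(c')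
for the largest value c' below `c`, where `betti_sublevel` applies. -/
theorem betti_strictSublevel (hK : (K : Set (Finset ι)).Finite) (hf : IsDiscreteMorse f)
    (hexc : IsExcellent f) (c : ℝ) (q : ℕ) :
    betti F (strictSublevel f c) q + (destroyers F f (q + 1) ∩ f ⁻¹' Set.Iio c).ncard =
      (creators F f q ∩ f ⁻¹' Set.Iio c).ncard := by
  have : Finite K := hK
  induction hn : (f ⁻¹' Set.Iio c).ncard using Nat.strong_induction_on generalizing c with
  | _ n ih =>
  rcases exists_last_value_lt hK f c with h | ⟨s₀, h1, h2⟩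
  · have hempty : f ⁻¹' Set.Iio c = ∅ :=
      Set.eq_empty_iff_forall_notMem.2 fun s hs => absurd hs (not_lt.2 (h s))
    have := betti_add_finrank F hK (strictSublevel_le f c) q
    rw [cycles_strictSublevel_eq_bot h, finrank_bot] at this
    simp only [hempty, Set.inter_empty, Set.ncard_empty]
    omega
  · have hpre : f ⁻¹' Set.Iio c = f ⁻¹' Set.Iic (f s₀) :=
      Set.ext fun s => ⟨h2 s, fun hs => lt_of_le_of_lt hs h1⟩
    rw [strictSublevel_eq_sublevel h1 h2, hpre, ncard_inter_Iic hK, ncard_inter_Iic hK]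
    have hlt : (f ⁻¹' Set.Iio (f s₀)).ncard < n := by
      rw [← hn]
      refine Set.ncard_lt_ncard ⟨fun s hs => lt_trans hs h1, fun hsub => ?_⟩
      exact lt_irrefl (f s₀) (hsub (show s₀ ∈ f ⁻¹' Set.Iio c from h1))
    have h3 := ih _ hlt (f s₀) rfl
    have h4 := betti_sublevel (F := F) hK hf hexc (f s₀) q
    omega

theorem betti_add_ncard_destroyers (hK : (K : Set (Finset ι)).Finite) (hf : IsDiscreteMorse f)
    (hexc : IsExcellent f) (q : ℕ) :
    betti F K q + (destroyers F f (q + 1)).ncard = (creators F f q).ncard := by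
  obtain ⟨c, h1, h2⟩ := exists_strictSublevel_eq hK f
  have h := betti_strictSublevel (F := F) hK hf hexc c q
  rwa [h2, show f ⁻¹' Set.Iio c = Set.univ from Set.eq_univ_of_forall h1, Set.inter_univ,
    Set.inter_univ] at h

theorem critCount_eq (hK : (K : Set (Finset ι)).Finite) (f : K → ℝ) (q : ℕ) :
    critCount f q = (creators F f q).ncard + (destroyers F f q).ncard := by
  have : Finite K := hK
  rw [critCount, ← Set.ncard_union_eq]
  · congr 1
    ext s
    by_cases h : IsCreator F f s <;> simp [creators, destroyers, h]
  · exact Set.disjoint_left.2 fun s h1 h2 => h2.2.2 h1.2.2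

/-- The boundary of a vertex is zero, hence bounds the zero chain. -/
theorem destroyers_zero (f : K → ℝ) : destroyers F f 0 = ∅ := by
  refine Set.eq_empty_iff_forall_notMem.2 fun s hs => hs.2.2 ?_
  rw [IsCreator, boundary_eq_zero_of_mem_chains_zero (single_mem_chains 1 s.2 hs.2.1)]
  exact zero_mem _

end Filtration

/-! ### Homology classes through representatives -/

section Classes

variable {F E : Type*} [Field F] [AddCommGroup E] [Module F E] {Z B Z' B' : Submodule F E}

/-- The class of an element of `Z` in `Z / B`. -/
def Subquotient.mk (z : Z) : Subquotient Z B :=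
  Submodule.Quotient.mk (p := B.submoduleOf Z) z

theorem Subquotient.mk_surjective (x : Subquotient Z B) : ∃ z : Z, Subquotient.mk z = x :=
  Submodule.Quotient.mk_surjective _ x

theorem Subquotient.mk_eq_mk_iff {z z' : Z} :
    (Subquotient.mk z : Subquotient Z B) = Subquotient.mk z' ↔ z.1 - z'.1 ∈ B :=
  Submodule.Quotient.eq (B.submoduleOf Z)

theorem Subquotient.map_mk (hZ : Z ≤ Z') (hB : B ≤ B') (z : Z) :
    Subquotient.map hZ hB (Subquotient.mk z) = Subquotient.mk ⟨z.1, hZ z.2⟩ := rfl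

theorem Subquotient.map_mk_eq_zero_iff (hZ : Z ≤ Z') (hB : B ≤ B') (z : Z) :
    Subquotient.map hZ hB (Subquotient.mk z) = 0 ↔ z.1 ∈ B' := by
  rw [Subquotient.map_mk, show (0 : Subquotient Z' B') = Subquotient.mk 0 from rfl,
    Subquotient.mk_eq_mk_iff, Submodule.coe_zero, sub_zero]

theorem Subquotient.mk_mem_range_map_iff (hZ : Z ≤ Z') (hB : B ≤ B') (z : Z') :
    Subquotient.mk z ∈ LinearMap.range (Subquotient.map hZ hB) ↔ z.1 ∈ Z ⊔ B' := by
  constructor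
  · rintro ⟨y, hy⟩
    obtain ⟨y, rfl⟩ := Subquotient.mk_surjective y
    rw [Subquotient.map_mk, eq_comm, Subquotient.mk_eq_mk_iff] at hy
    exact add_sub_cancel y.1 z.1 ▸ Submodule.add_mem_sup y.2 hy
  · intro hz
    obtain ⟨y, hy, b, hb, hyb⟩ := Submodule.mem_sup.1 hz
    refine ⟨Subquotient.mk ⟨y, hy⟩, ?_⟩
    rw [Subquotient.map_mk, eq_comm, Subquotient.mk_eq_mk_iff, ← hyb, add_sub_cancel_left]
    exact hb

end Classes

/-! ### Persistence pairs and destroyers -/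

section Pairs

variable {ι : Type*} [LinearOrder ι] {F : Type*} [Field F] {K : PreAbstractSimplicialComplex ι}
  {f : K → ℝ}

/-- Persistence pairs in terms of cycles. -/
theorem isPersistencePair_iff {s t : K} :
    IsPersistencePair F f s t ↔ IsCritical f s ∧ IsCritical f t ∧ f s < f t ∧
      ∃ (p : ℕ) (x : Finset ι →₀ F), x ∈ cycles F (sublevel f (f s)) p ∧
        x ∉ cycles F (strictSublevel f (f s)) p ⊔ boundaries F (strictSublevel f (f t)) p ∧
        x ∈ boundaries F (sublevel f (f t)) p := by
  constructor
  · rintro ⟨hs, ht, p, x, -, hlt, h1, h2⟩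
    obtain ⟨x, rfl⟩ := Subquotient.mk_surjective x
    exact ⟨hs, ht, hlt, p, x.1, x.2,
      fun h => h1 ((Subquotient.mk_mem_range_map_iff _ _ _).2 h),
      (Subquotient.map_mk_eq_zero_iff _ _ _).1 h2⟩
  · rintro ⟨hs, ht, hlt, p, x, hx, h1, h2⟩
    exact ⟨hs, ht, p, Subquotient.mk ⟨x, hx⟩, fun h => h1 (sup_le_sup_left
        (boundaries_mono F (sublevel_le_strictSublevel f hlt) p) _
        ((Subquotient.mk_mem_range_map_iff _ _ _).1 h)), hlt,
      fun h => h1 ((Subquotient.mk_mem_range_map_iff _ _ _).1 h),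
      (Subquotient.map_mk_eq_zero_iff _ _ _).2 h2⟩

/-- Modulo boundaries of K(f t)⁻, the dying cycle is a nonzero multiple of ∂t. So the pair is
governed by ∂t alone, and the degree and both dimensions are forced. -/
theorem IsPersistencePair.exists_boundary_mem (hf : IsDiscreteMorse f) (hexc : IsExcellent f)
    {s t : K} (h : IsPersistencePair F f s t) :
    ∃ p, s.1.card = p + 1 ∧ t ∈ destroyers F f (p + 1) ∧
      boundary F (Finsupp.single t.1 1) ∈
        cycles F (sublevel f (f s)) p ⊔ boundaries F (strictSublevel f (f t)) p ∧
      boundary F (Finsupp.single t.1 1) ∉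
        cycles F (strictSublevel f (f s)) p ⊔ boundaries F (strictSublevel f (f t)) p := by
  obtain ⟨hs, ht, hlt, p, x, hx, h1, h2⟩ := isPersistencePair_iff.1 h
  obtain ⟨s', hs', hss', -⟩ := exists_creator_of_cycle hf hexc hx fun h => h1
    (sup_le_sup_left (boundaries_mono F (sublevel_le_strictSublevel f hlt) p) _ h)
  obtain rfl : s' = s := hexc hs'.1 hs hss'
  obtain ⟨t', ht', htt', a, ha, hax⟩ := exists_destroyer_of_boundary hf hexc
    (cycles_mono F (sublevel_le_strictSublevel f hlt) p hx) h2
    fun h => h1 (Submodule.mem_sup_right h)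
  obtain rfl : t' = t := hexc ht'.1 ht htt'
  refine ⟨p, hs'.2.1, ht', ?_, fun h => h1 ?_⟩
  · rw [← Submodule.smul_mem_iff _ ha]
    exact sub_sub_cancel x (a • boundary F (Finsupp.single t'.1 1)) ▸
      sub_mem (Submodule.mem_sup_left hx) (Submodule.mem_sup_right hax)
  · exact sub_add_cancel x (a • boundary F (Finsupp.single t'.1 1)) ▸
      add_mem (Submodule.mem_sup_right hax) (Submodule.smul_mem _ a h)

/-- The partner of `t` sits at the lowest level carrying a cycle homologous to ∂t in K(f t)⁻. Such a
level exists because ∂t does not bound there, so the empty complex carries no such cycle. -/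
theorem exists_isPersistencePair (hK : (K : Set (Finset ι)).Finite) (hf : IsDiscreteMorse f)
    (hexc : IsExcellent f) {q : ℕ} {t : K} (ht : t ∈ destroyers F f (q + 1)) :
    ∃ s, IsPersistencePair F f s t ∧ s.1.card = q + 1 := by
  have : Finite K := hK
  set z := boundary F (Finsupp.single t.1 1)
  have hzL : z ∉ boundaries F (strictSublevel f (f t)) q :=
    fun h => ht.2.2 ((isCreator_iff ht.2.1).2 h)
  have hstep : ∀ c, z ∈ cycles F (strictSublevel f c) q ⊔ boundaries F (strictSublevel f (f t)) q →
      ∃ r, f r < c ∧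
        z ∈ cycles F (sublevel f (f r)) q ⊔ boundaries F (strictSublevel f (f t)) q := by
    intro c hc
    rcases exists_last_value_lt hK f c with h | ⟨r, h1, h2⟩
    · rw [cycles_strictSublevel_eq_bot h, bot_sup_eq] at hc
      exact absurd hc hzL
    · exact ⟨r, h1, strictSublevel_eq_sublevel h1 h2 ▸ hc⟩
  obtain ⟨r₀, hr₀, hzr₀⟩ := hstep (f t) (Submodule.mem_sup_left
    ⟨boundary_single_mem_chains ht.1 ht.2.1, boundary_boundary _⟩)
  obtain ⟨r, ⟨hrt, hzr⟩, hmin⟩ := Set.exists_min_image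
    {r | f r < f t ∧
      z ∈ cycles F (sublevel f (f r)) q ⊔ boundaries F (strictSublevel f (f t)) q} f
    (Set.toFinite _) ⟨r₀, hr₀, hzr₀⟩
  have hzr' : z ∉ cycles F (strictSublevel f (f r)) q ⊔
      boundaries F (strictSublevel f (f t)) q := fun h => by
    obtain ⟨r', h1, h2⟩ := hstep _ h
    exact absurd (hmin r' ⟨h1.trans hrt, h2⟩) (not_le.2 h1)
  obtain ⟨x, hx, b, hb, hxb⟩ := Submodule.mem_sup.1 hzr
  have hx' : x ∉ cycles F (strictSublevel f (f r)) q ⊔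
      boundaries F (strictSublevel f (f t)) q := fun h =>
    hzr' (hxb ▸ add_mem h (Submodule.mem_sup_right hb))
  -- The minimizing `r` need not be critical, but the cycle `x` is new at its value, so a creator
  -- has the same value.
  obtain ⟨s, hs, hsr, -⟩ := exists_creator_of_cycle hf hexc hx fun h => hx'
    (sup_le_sup_left (boundaries_mono F (sublevel_le_strictSublevel f hrt) q) _ h)
  rw [← hsr] at hx hx' hrt
  refine ⟨s, isPersistencePair_iff.2 ⟨hs.1, ht.1, hrt, q, x, hx, hx', ?_⟩, hs.2.1⟩
  rw [← sub_eq_iff_eq_add.2 hxb.symm]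
  exact sub_mem ⟨_, single_mem_chains 1 (mem_sublevel_of_le le_rfl) ht.2.1, rfl⟩
    (boundaries_mono F (strictSublevel_le_sublevel f le_rfl) q hb)

theorem ncard_finitePairs (hK : (K : Set (Finset ι)).Finite) (hf : IsDiscreteMorse f)
    (hexc : IsExcellent f) (q : ℕ) :
    (finitePairs F f q).ncard = (destroyers F f (q + 1)).ncard := by
  have hinj : Set.InjOn Prod.snd (finitePairs F f q) := by
    -- If `f s < f s'`, then ∂t would be represented in K(f s), hence before `s'`, against the elder
    -- rule for `(s', t)`.
    have key : ∀ {s s' t : K}, IsPersistencePair F f s t → IsPersistencePair F f s' t →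
        s.1.card = s'.1.card → f s' ≤ f s := by
      intro s s' t h h' hcard
      obtain ⟨p, hp, -, hmem, -⟩ := h.exists_boundary_mem hf hexc
      obtain ⟨p', hp', -, -, hnot⟩ := h'.exists_boundary_mem hf hexc
      obtain rfl : p' = p := by omega
      by_contra! hlt
      exact hnot (sup_le_sup_right (cycles_mono F (sublevel_le_strictSublevel f hlt) _) _ hmem)
    rintro ⟨s, t⟩ ⟨h, hs⟩ ⟨s', t'⟩ ⟨h', hs'⟩ (rfl : t = t')
    have : s = s' := hexc h.1 h'.1
      ((key h' h (hs'.trans hs.symm)).antisymm (key h h' (hs.trans hs'.symm)))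
    rw [this]
  rw [← hinj.ncard_image]
  congr 1
  ext t
  constructor
  · rintro ⟨⟨s, t⟩, ⟨h, hs⟩, rfl⟩
    obtain ⟨p, hp, ht, -⟩ := h.exists_boundary_mem hf hexc
    obtain rfl : p = q := Nat.succ.inj (hp.symm.trans hs)
    exact ht
  · intro ht
    obtain ⟨s, hs⟩ := exists_isPersistencePair hK hf hexc ht
    exact ⟨(s, t), hs, rfl⟩

end Pairs

/-! ### Alternating sums and the theorem -/

theorem alternating_sum_succ (x : ℕ → ℤ) (i : ℕ) :
    ∑ k ∈ Finset.range (i + 2), (-1 : ℤ) ^ (i + 1 - k) * x k =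
      x (i + 1) - ∑ k ∈ Finset.range (i + 1), (-1 : ℤ) ^ (i - k) * x k := by
  rw [Finset.sum_range_succ, Nat.sub_self, pow_zero, one_mul, sub_eq_add_neg, add_comm,
    ← Finset.sum_neg_distrib]
  congr 1
  refine Finset.sum_congr rfl fun k hk => ?_
  rw [Nat.succ_sub (Nat.lt_succ_iff.1 (Finset.mem_range.1 hk)), pow_succ]
  ring

theorem alternating_sum_critCount {ι : Type*} [LinearOrder ι] {F : Type*} [Field F]
    {K : PreAbstractSimplicialComplex ι} (hK : (K : Set (Finset ι)).Finite) {f : K → ℝ}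
    (hf : IsDiscreteMorse f) (hexc : IsExcellent f) (i : ℕ) :
    ∑ k ∈ Finset.range (i + 1), (-1 : ℤ) ^ (i - k) * (critCount f k : ℤ) =
      ∑ k ∈ Finset.range (i + 1), (-1 : ℤ) ^ (i - k) * (betti F K k : ℤ) +
        ((finitePairs F f i).ncard : ℤ) := by
  rw [ncard_finitePairs hK hf hexc]
  induction i with
  | zero =>
    have h1 := betti_add_ncard_destroyers (F := F) hK hf hexc 0
    have h2 := critCount_eq (F := F) hK f 0
    rw [destroyers_zero, Set.ncard_empty] at h2
    rw [zero_add] at h1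
    simp
    omega
  | succ i ih =>
    -- The destroyers of dimension `i + 1` left over by the previous sum cancel those counted in
    -- C_{i+1}.
    rw [alternating_sum_succ, alternating_sum_succ, ih]
    have h1 := betti_add_ncard_destroyers (F := F) hK hf hexc (i + 1)
    have h2 := critCount_eq (F := F) hK f (i + 1)
    omega

end DiscreteMorse

theorem corollary3p8 {ι : Type*} [LinearOrder ι] {F : Type*} [Field F] [Finite F]
    (K : PreAbstractSimplicialComplex ι) (hK : (K : Set (Finset ι)).Finite)
    (n : ℕ) (hn : DiscreteMorse.HasDimension K n)
    (f : K → ℝ) (hf : DiscreteMorse.IsDiscreteMorse f) (hexc : DiscreteMorse.IsExcellent f) :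
    (∑ k ∈ Finset.range (n + 1), (-1 : ℤ) ^ (n - k) * (DiscreteMorse.critCount f k : ℤ) =
      ∑ k ∈ Finset.range (n + 1), (-1 : ℤ) ^ (n - k) * (DiscreteMorse.betti F K k : ℤ)) ∧
    ∀ i : ℕ, i ≤ n →
      ∑ k ∈ Finset.range (i + 1), (-1 : ℤ) ^ (i - k) * (DiscreteMorse.critCount f k : ℤ) =
        ∑ k ∈ Finset.range (i + 1), (-1 : ℤ) ^ (i - k) * (DiscreteMorse.betti F K k : ℤ) +
          ((DiscreteMorse.finitePairs F f i).ncard : ℤ) := by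
  refine ⟨?_, fun i _ => DiscreteMorse.alternating_sum_critCount hK hf hexc i⟩
  -- The correction term for i = n counts simplices of dimension n + 1, and there are none.
  have hempty : DiscreteMorse.destroyers F f (n + 1) = ∅ := by
    refine Set.eq_empty_iff_forall_notMem.2 fun s hs => ?_
    exact absurd (hn.2 ⟨s.1, s.2, hs.2.1⟩) (Nat.not_succ_le_self n)
  rw [DiscreteMorse.alternating_sum_critCount (F := F) hK hf hexc n,
    DiscreteMorse.ncard_finitePairs hK hf hexc, hempty, Set.ncard_empty, Nat.cast_zero, add_zero]
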